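/- **Setting.** Let $\mathcal L$ be a finite set of links with capacities $C_l>0$. Let $\mathcal I$ be the finite set of pairs $(k,p)$ of a user $k$ and a candidate path $p$ of that user; the path of $i\in\mathcal I$ consists of a non-empty set $\mathcal L_i\subseteq\mathcal L$ of links. Let $D\subseteq\mathbb R$ be a convex set containing $[0,\infty)$, the domain of the costs, and let each cost $\psi_i:D\to\mathbb R$ be strictly convex and differentiable (one-sidedly at an endpoint of $D$). The multi-path routing problem is $$\min_{\mathbf r}\ \psi(\mathbf r)=\sum_{i\in\mathcal I}\psi_i(r_i)\quad\text{s.t.}\quad \sum_{i:\,l\in\mathcal L_i}r_i\le C_l\ (l\in\mathcal L),\qquad r_i\ge 0\ (i\in\mathcal I).$$ Its dual problem is to maximise $\inf_{\mathbf r\in D^{\mathcal I}}L_c(\mathbf r,\mu,\phi)$ over $\mu\ge0$, $\phi\ge0$, where $$L_c(\mathbf r,\mu,\phi)=\sum_i\psi_i(r_i)+\sum_l\mu_l\Big(\sum_{i:\,l\in\mathcal L_i}r_i-C_l\Big)-\sum_i\phi_ir_i .$$ **Algorithm.** Start with any $\mu^0$ with all $\mu^0_l>0$. In iteration $j\to j+1$,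 all links $l$ with $\mu^j_l>0$ solve, in parallel, the per-link problem $$\min\ \sum_{i:\,l\in\mathcal L_i}\alpha_{i,l}\,\psi_i(r_i)\quad\text{s.t.}\quad\sum_{i:\,l\in\mathcal L_i}r_i\le C_l,\quad \alpha_{i,l}r_i\ge0,\qquad \alpha_{i,l}=\frac{\mu^j_l}{\sum_{l'\in\mathcal L_i}\mu^j_{l'}},$$ that is, they find rates $r^{j+1}_{l,i}$, a capacity multiplier $\mu_l^{j+1}$ and sign multipliers $\phi^{j+1}_{l,i}$ that satisfy its KKT conditions. Links with $\mu^j_l=0$ keep their values. After iteration $j$ the rate and the sign multiplier of $i$ are read off from a link $s_j(i)\in\mathcal L_i$ on its path whose multiplier is positive and not vanishing relative to the path: for some $\delta>0$ independent of $i$ and $j$, $\mu^j_{s_j(i)}\ge\delta\sum_{l\in\mathcal L_i}\mu^j_l$ (for instance, a link of the path with the largest multiplier). The primal iterate is $r^j_i=r^j_{s_j(i),i}$ and the dual iterate is $(\mu^j,\phi^j)$ with $\phi^j_i=\phi^j_{s_j(i),i}$. **Theorem 1.** The algorithm can be run from every $\mu^0>0$, the dual problem has an optimal solution, and the routing problem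 has an optimal solution $\mathbf r^\star$ such that for every run of the algorithm: 1. $\mu^{j+1}-\mu^j\to0$, so that the stopping criterion $\|\mu^{j}-\mu^{j-1}\|<\epsilon$ is met for every $\epsilon>0$; 2. selections $s_j$ as above exist, and for every such selection the primal iterates $\mathbf r^j$ converge to $\mathbf r^\star$ and the dual iterates $(\mu^j,\phi^j)$ converge to the set of optimal solutions of the dual problem (their distance to it tends to $0$). -/

import Mathlib

open Filter Topology

/-- Data of a multi-path routing problem. The index type `ι` is the finite set of pairs
`(k, p)`, where `k` is a user and `p` is a candidate path of user `k`; `L` is the finite set of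
links. Pairs `(k, p)` are called flows below. -/
structure RoutingProblem (ι L : Type*) where
  /-- the set of links that the path of a flow consists of -/
  links : ι → Finset L
  /-- the capacity of a link -/
  cap : L → ℝ
  /-- the interval on which the cost functions are defined, typically `ℝ` or `[0, ∞)` -/
  dom : Set ℝ
  /-- the cost of a flow as a function of its rate -/
  cost : ι → ℝ → ℝ

namespace RoutingProblem

variable {ι L : Type*} [Fintype ι] [Fintype L] [DecidableEq L] (P : RoutingProblem ι L)

/-- The flows whose path uses link `l`. -/
def flows (l : L) : Finset ι := Finset.univ.filter fun p => l ∈ P.links p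

/-- Total rate on link `l`. -/
def load (r : ι → ℝ) (l : L) : ℝ := ∑ p ∈ P.flows l, r p

/-- The separable cost function. -/
def objective (r : ι → ℝ) : ℝ := ∑ p, P.cost p (r p)

/-- The capacity and the sign constraints. -/
def IsFeasible (r : ι → ℝ) : Prop := (∀ l, P.load r l ≤ P.cap l) ∧ ∀ p, 0 ≤ r p

/-- `r` is an optimal solution of the routing problem. -/
def IsPrimalOptimal (r : ι → ℝ) : Prop :=
  P.IsFeasible r ∧ ∀ r', P.IsFeasible r' → P.objective r ≤ P.objective r'

/-- The Lagrangian, with multipliers `μ` for the capacities and `φ` for the signs. -/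
def lagrangian (r : ι → ℝ) (μ : L → ℝ) (φ : ι → ℝ) : ℝ :=
  ∑ p, P.cost p (r p) + ∑ l, μ l * (P.load r l - P.cap l) - ∑ p, φ p * r p

/-- The dual function: the infimum of the Lagrangian over all `r` in the domain of the cost
(possibly `-∞`). -/
noncomputable def dualFunction (μ : L → ℝ) (φ : ι → ℝ) : EReal :=
  ⨅ r ∈ {r : ι → ℝ | ∀ p, r p ∈ P.dom}, (P.lagrangian r μ φ : EReal)

/-- The set of optimal solutions `(μ, φ)` of the dual problem. -/
def dualSolutions : Set ((L → ℝ) × (ι → ℝ)) :=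
  {d | 0 ≤ d.1 ∧ 0 ≤ d.2 ∧ ∀ (μ : L → ℝ) (φ : ι → ℝ), 0 ≤ μ → 0 ≤ φ →
    P.dualFunction μ φ ≤ P.dualFunction d.1 d.2}

/-- The portion of the cost of flow `p` that link `l` receives when the link multipliers
are `μ`. -/
noncomputable def share (μ : L → ℝ) (p : ι) (l : L) : ℝ := μ l / ∑ l' ∈ P.links p, μ l'

/-- The optimality (KKT) conditions of the subproblem of link `l`: minimise
`∑ α p * cost p (r p)` over the flows `p` on link `l`, subject to the capacity of `l` and to
`α p * r p ≥ 0`. Here `m` is the multiplier of the capacity and `φ p` that of the sign of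
`r p`. Entries of `r` and `φ` at flows that do not use `l` play no role. -/
structure IsLinkSolution (l : L) (α : ι → ℝ) (r : ι → ℝ) (m : ℝ) (φ : ι → ℝ) : Prop where
  stationary : ∀ p ∈ P.flows l,
    α p * derivWithin (P.cost p) P.dom (r p) + m - α p * φ p = 0
  capacity : P.load r l ≤ P.cap l
  multiplier_nonneg : 0 ≤ m
  slackness : m * (P.load r l - P.cap l) = 0
  rate_nonneg : ∀ p ∈ P.flows l, 0 ≤ r p
  sign_nonneg : ∀ p ∈ P.flows l, 0 ≤ φ p
  sign_slackness : ∀ p ∈ P.flows l, α p * r p * φ p = 0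

/-- A run of the link-level decomposed dual algorithm. `μ j l` is the multiplier of link `l`
after `j` iterations; `r j l p` and `φ j l p` are the latest rate of flow `p` and the latest
multiplier of its sign constraint that link `l` has computed by then (arbitrary for `j = 0`).
In each iteration all links with a positive multiplier solve their subproblems in parallel;
the other links stay idle. -/
structure IsRun (μ : ℕ → L → ℝ) (r φ : ℕ → L → ι → ℝ) : Prop where
  init : ∀ l, 0 < μ 0 l
  active : ∀ j l, 0 < μ j l →
    P.IsLinkSolution l (fun p => P.share (μ j) p l) (r (j + 1) l) (μ (j + 1) l) (φ (j + 1) l)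
  idle : ∀ j l, ¬ 0 < μ j l →
    μ (j + 1) l = μ j l ∧ r (j + 1) l = r j l ∧ φ (j + 1) l = φ j l

/-- A rule that selects, after each iteration `j` and for each flow `p`, the link `s j p` on the
path of `p` from which the rate of `p` is read off. The multiplier of the selected link has to be
positive, by a fixed fraction `δ` of the sum of the multipliers along the path, unless all
multipliers along the path vanish. -/
def IsReadout (μ : ℕ → L → ℝ) (s : ℕ → ι → L) : Prop :=
  (∀ j p, s j p ∈ P.links p) ∧
    ∃ δ > 0, ∀ j p, δ * ∑ l ∈ P.links p, μ j l ≤ μ j (s j p)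

end RoutingProblem

/-! Once its KKT conditions are divided by the shares, a link `l` merely posts a factor `ρ = μ' l /
μ l`: each flow on it faces `ρ` times its path price and takes the unique minimiser of cost plus
price (`response`). This response is continuous and nonincreasing in the price, and where it is
positive and below `rateBound` it determines the price.

The shares along a path of positive price sum to one, so the dual function splits over the links.
One iteration therefore raises it by at least a sum of nonnegative terms: share times regret, and
multiplier change times slack (`IsStep.ascent`). The dual function is bounded above and, as
capacities are positive, its monotonicity bounds the multipliers. The gains vanish, so along every
ultrafilter consecutive multipliers have a common limit, and links with positive limit are saturated
(`link_limit`).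

Such a limit might still overload a link of multiplier zero. But its rates depend only on the
support of the multipliers, so finitely many rate vectors are possible, and vanishing increments
force the responses to converge. A link overloaded in the limit would have an eventually increasing
multiplier, hence a positive limit, hence be saturated: a contradiction. Thus all limits are
equilibria, which give saddle points and share the same rates.

It remains to see that the rates read off from the links follow. This is delicate on paths whose
price vanishes, where `exists_ratio_bound` keeps the posted price from staying away from zero. -/

set_option linter.unusedSectionVars false

namespace RoutingProblem

variable {ι L : Type*} [Fintype ι] [Fintype L] [DecidableEq L] (P : RoutingProblem ι L)

/-! ### The response of a single flow to a price -/

/-- The standing assumptions on a routing problem. -/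
structure Regular : Prop where
  links_nonempty : ∀ p, (P.links p).Nonempty
  cap_pos : ∀ l, 0 < P.cap l
  convex_dom : Convex ℝ P.dom
  Ici_subset_dom : Set.Ici 0 ⊆ P.dom
  strictConvexOn : ∀ p, StrictConvexOn ℝ P.dom (P.cost p)
  differentiableOn : ∀ p, DifferentiableOn ℝ (P.cost p) P.dom

/-- A number larger than every capacity. -/
noncomputable def rateBound : ℝ := 1 + ∑ l, |P.cap l|

/-- The rate in `[0, rateBound]` that flow `p` chooses when its path has price `y`. -/
noncomputable def response (p : ι) (y : ℝ) : ℝ :=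
  Classical.epsilon fun x => x ∈ Set.Icc 0 P.rateBound ∧
    IsMinOn (fun t => P.cost p t + y * t) (Set.Icc 0 P.rateBound) x

/-- The optimality conditions of a single flow with price `y`, rate `r` and sign multiplier `φ`. -/
structure IsStationary (p : ι) (y r φ : ℝ) : Prop where
  deriv_eq : derivWithin (P.cost p) P.dom r + y - φ = 0
  rate_nonneg : 0 ≤ r
  sign_nonneg : 0 ≤ φ
  slackness : r * φ = 0

/-- Strictness matters: a rate that respects a capacity stays off the artificial upper end, so
truncation does not disturb its optimality conditions. -/
theorem cap_lt_rateBound (l : L) : P.cap l < P.rateBound := by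
  have h1 : |P.cap l| ≤ ∑ l, |P.cap l| :=
    Finset.single_le_sum (f := fun l => |P.cap l|) (fun _ _ => abs_nonneg _) (Finset.mem_univ l)
  have h2 := le_abs_self (P.cap l)
  unfold rateBound
  linarith

theorem rateBound_pos : 0 < P.rateBound := by
  have : 0 ≤ ∑ l, |P.cap l| := Finset.sum_nonneg fun _ _ => abs_nonneg _
  unfold rateBound
  linarith

/-- A convex function lies above its tangents. -/
theorem _root_.ConvexOn.add_derivWithin_mul_le {D : Set ℝ} {f : ℝ → ℝ} (hf : ConvexOn ℝ D f)
    (hd : DifferentiableOn ℝ f D) {x t : ℝ} (hx : x ∈ D) (ht : t ∈ D) :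
    f x + derivWithin f D x * (t - x) ≤ f t := by
  rcases lt_trichotomy x t with h | h | h
  · have := hf.derivWithin_le_slope hx ht h (hd x hx)
    rw [slope_def_field, le_div_iff₀ (by linarith)] at this
    linarith
  · simp [h]
  · have := hf.slope_le_derivWithin ht hx h (hd x hx)
    rw [slope_def_field, div_le_iff₀ (by linarith)] at this
    linarith

namespace Regular

variable {P}

theorem mem_dom (H : P.Regular) {x : ℝ} (hx : 0 ≤ x) : x ∈ P.dom := H.Ici_subset_dom hx

theorem continuousOn_cost (H : P.Regular) (p : ι) : ContinuousOn (P.cost p) (Set.Icc 0 P.rateBound) :=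
  (H.differentiableOn p).continuousOn.mono fun _ hx => H.mem_dom hx.1

theorem response_spec (H : P.Regular) (p : ι) (y : ℝ) :
    P.response p y ∈ Set.Icc 0 P.rateBound ∧
      IsMinOn (fun t => P.cost p t + y * t) (Set.Icc 0 P.rateBound) (P.response p y) := by
  refine Classical.epsilon_spec (p := fun x => x ∈ Set.Icc 0 P.rateBound ∧
    IsMinOn (fun t => P.cost p t + y * t) (Set.Icc 0 P.rateBound) x) ?_
  refine isCompact_Icc.exists_isMinOn (Set.nonempty_Icc.2 P.rateBound_pos.le) ?_
  exact (H.continuousOn_cost p).add (by fun_prop)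

theorem response_le (H : P.Regular) (p : ι) (y : ℝ) {t : ℝ} (ht : t ∈ Set.Icc 0 P.rateBound) :
    P.cost p (P.response p y) + y * P.response p y ≤ P.cost p t + y * t :=
  (H.response_spec p y).2 ht

theorem eq_response (H : P.Regular) {p : ι} {y x : ℝ} (hx : x ∈ Set.Icc 0 P.rateBound)
    (hmin : ∀ t ∈ Set.Icc 0 P.rateBound, P.cost p x + y * x ≤ P.cost p t + y * t) :
    x = P.response p y := by
  have hc : StrictConvexOn ℝ (Set.Icc 0 P.rateBound) fun t => P.cost p t + y * t := by
    refine ((H.strictConvexOn p).subset (fun _ h => H.mem_dom h.1) (convex_Icc _ _)).add_convexOn ?_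
    exact ((LinearMap.mulLeft ℝ y).convexOn (convex_Icc _ _))
  exact hc.eq_of_isMinOn (fun t ht => hmin t ht) (H.response_spec p y).2 hx (H.response_spec p y).1

/-- Each minimality inequality is tested with the other minimiser; in the sum the costs cancel. -/
theorem response_mul_nonpos (H : P.Regular) (p : ι) (y y' : ℝ) :
    (y - y') * (P.response p y - P.response p y') ≤ 0 := by
  have h1 := H.response_le p y (H.response_spec p y').1
  have h2 := H.response_le p y' (H.response_spec p y).1
  linarith

theorem antitone_response (H : P.Regular) (p : ι) : Antitone (P.response p) := by
  intro y y' h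
  rcases h.eq_or_lt with rfl | h
  · rfl
  · nlinarith [H.response_mul_nonpos p y y']

theorem response_nonneg (H : P.Regular) (p : ι) (y : ℝ) : 0 ≤ P.response p y := (H.response_spec p y).1.1

/-- By compactness the responses converge along any ultrafilter; the limit is again a minimiser, and
minimisers are unique. -/
theorem continuous_response (H : P.Regular) (p : ι) : Continuous (P.response p) := by
  rw [continuous_iff_ultrafilter]
  intro y U hU
  obtain ⟨x, hx, hxU⟩ := (isCompact_Icc (a := (0 : ℝ)) (b := P.rateBound)).ultrafilter_le_nhds
    (U.map (P.response p)) (by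
      rw [le_principal_iff]
      exact Eventually.of_forall (f := (U : Filter ℝ)) fun y => (H.response_spec p y).1)
  have hx' : Tendsto (P.response p) U (𝓝 x) := hxU
  suffices x = P.response p y by rwa [← this]
  refine H.eq_response hx fun t ht => ?_
  have hcost : Tendsto (fun z => P.cost p (P.response p z)) U (𝓝 (P.cost p x)) :=
    (H.continuousOn_cost p x hx).tendsto.comp
      (tendsto_nhdsWithin_iff.2 ⟨hx', Eventually.of_forall fun z => (H.response_spec p z).1⟩)
  have hid : Tendsto (fun z : ℝ => z) U (𝓝 y) := hU
  exact le_of_tendsto_of_tendsto' (hcost.add (hid.mul hx'))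
    (tendsto_const_nhds.add (hid.mul_const t)) fun z => H.response_le p z ht

theorem _root_.RoutingProblem.IsStationary.le {p : ι} {y r φ : ℝ}
    (h : P.IsStationary p y r φ) (H : P.Regular) {t : ℝ} (ht : t ∈ P.dom) :
    P.cost p r + (y - φ) * r ≤ P.cost p t + (y - φ) * t := by
  have h1 := (H.strictConvexOn p).convexOn.add_derivWithin_mul_le (H.differentiableOn p)
    (H.mem_dom h.rate_nonneg) ht
  have h2 : derivWithin (P.cost p) P.dom r = φ - y := by linarith [h.deriv_eq]
  rw [h2] at h1
  linarith

theorem _root_.RoutingProblem.IsStationary.eq_response {p : ι} {y r φ : ℝ}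
    (h : P.IsStationary p y r φ) (H : P.Regular) (hr : r ≤ P.rateBound) :
    r = P.response p y := by
  refine H.eq_response ⟨h.rate_nonneg, hr⟩ fun t ht => ?_
  have h1 := h.le H (H.mem_dom ht.1)
  nlinarith [h.slackness, mul_nonneg h.sign_nonneg ht.1]

/-- The sign multiplier is the derivative of cost plus price at the minimiser. Testing minimality at
the upper end shows that it is nonnegative, testing at `0` gives slackness. -/
theorem isStationary_response (H : P.Regular) {p : ι} {y : ℝ} (hlt : P.response p y < P.rateBound) :
    P.IsStationary p y (P.response p y)
      (derivWithin (P.cost p) P.dom (P.response p y) + y) := by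
  set x := P.response p y with hxdef
  obtain ⟨hx, hmin⟩ := H.response_spec p y
  rw [← hxdef] at hx hmin
  have hder : HasDerivWithinAt (fun t => P.cost p t + y * t)
      (derivWithin (P.cost p) P.dom x + y) (Set.Icc 0 P.rateBound) x := by
    have h1 := ((H.differentiableOn p x (H.mem_dom hx.1)).hasDerivWithinAt).mono
      (fun t (ht : t ∈ Set.Icc 0 P.rateBound) => H.mem_dom ht.1)
    have h2 := (hasDerivWithinAt_id x (Set.Icc 0 P.rateBound)).const_mul y
    refine (h1.add h2).congr_deriv (by simp)
  have key : ∀ t ∈ Set.Icc 0 P.rateBound,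
      0 ≤ (t - x) * (derivWithin (P.cost p) P.dom x + y) := by
    intro t ht
    have := (hmin.localize).hasFDerivWithinAt_nonneg hder.hasFDerivWithinAt
      (sub_mem_posTangentConeAt_of_segment_subset ((convex_Icc 0 P.rateBound).segment_subset hx ht))
    simpa using this
  have h0 := key 0 ⟨le_rfl, P.rateBound_pos.le⟩
  have h1 : 0 ≤ derivWithin (P.cost p) P.dom x + y :=
    nonneg_of_mul_nonneg_right (key _ ⟨P.rateBound_pos.le, le_rfl⟩) (sub_pos.2 hlt)
  exact ⟨by ring, hx.1, h1, le_antisymm (by linarith) (mul_nonneg hx.1 h1)⟩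

/-- At a positive rate the sign multiplier vanishes, so the price is minus the marginal cost there.
This is where differentiability, rather than mere convexity, is essential. -/
theorem eq_of_response_eq (H : P.Regular) {p : ι} {y y' : ℝ} (h0 : 0 < P.response p y)
    (hlt : P.response p y < P.rateBound) (h : P.response p y = P.response p y') : y = y' := by
  have h1 := H.isStationary_response hlt
  have h2 := H.isStationary_response (h ▸ hlt)
  have e1 := (mul_eq_zero.1 h1.slackness).resolve_left h0.ne'
  have e2 := (mul_eq_zero.1 h2.slackness).resolve_left (h ▸ h0).ne'
  rw [← h] at e2
  linarith

theorem response_eq_zero (H : P.Regular) {p : ι} {y : ℝ} (hy : -derivWithin (P.cost p) P.dom 0 ≤ y) :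
    P.response p y = 0 := by
  have : P.IsStationary p y 0 (derivWithin (P.cost p) P.dom 0 + y) :=
    ⟨by ring, le_rfl, by linarith, by ring⟩
  exact (this.eq_response H P.rateBound_pos.le).symm

end Regular

/-! ### Dual ascent in one iteration -/

section

variable {P}

/-- The price of the path of a flow: the sum of the multipliers of its links. -/
def price (P : RoutingProblem ι L) (μ : L → ℝ) (p : ι) : ℝ := ∑ l ∈ P.links p, μ l

/-- The rates that the flows choose when the links have multipliers `μ`. -/
noncomputable def responses (P : RoutingProblem ι L) (μ : L → ℝ) (p : ι) : ℝ :=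
  P.response p (P.price μ p)

/-- The dual function of the capacity constraints, with rates confined to `[0, rateBound]`. -/
noncomputable def boundedDual (P : RoutingProblem ι L) (μ : L → ℝ) : ℝ :=
  ∑ p, (P.cost p (P.responses μ p) + P.price μ p * P.responses μ p) - ∑ l, μ l * P.cap l

/-- The amount by which the rate `x` misses the optimal value at the prices `μ`. -/
noncomputable def regret (P : RoutingProblem ι L) (μ : L → ℝ) (p : ι) (x : ℝ) : ℝ :=
  (P.cost p x + P.price μ p * x) -
    (P.cost p (P.responses μ p) + P.price μ p * P.responses μ p)

/-- One iteration of the algorithm leads from the multipliers `μ` to `μ'`; afterwards the links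
hold the rates `r` and the sign multipliers `φ`. -/
structure IsStep (P : RoutingProblem ι L) (μ μ' : L → ℝ) (r φ : L → ι → ℝ) : Prop where
  nonneg : 0 ≤ μ
  nonneg' : 0 ≤ μ'
  stationary : ∀ l, ∀ p ∈ P.flows l,
    P.IsStationary p (μ' l / μ l * P.price μ p) (r l p) (φ l p)
  load_le : ∀ l, P.load (r l) l ≤ P.cap l
  slackness : ∀ l, μ' l * (P.load (r l) l - P.cap l) = 0
  idle : ∀ l, μ l = 0 → μ' l = 0

theorem mem_flows {l : L} {p : ι} : p ∈ P.flows l ↔ l ∈ P.links p := by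
  simp [flows]

theorem sum_links_comm (F : ι → L → ℝ) :
    ∑ p, ∑ l ∈ P.links p, F p l = ∑ l, ∑ p ∈ P.flows l, F p l :=
  Finset.sum_comm' fun p l => by simp [mem_flows]

theorem sum_price_mul (μ : L → ℝ) (x : ι → ℝ) :
    ∑ p, P.price μ p * x p = ∑ l, μ l * P.load x l := by
  simp only [price, load, Finset.sum_mul, Finset.mul_sum]
  exact sum_links_comm fun p l => μ l * x p

theorem le_price {μ : L → ℝ} (hμ : 0 ≤ μ) {p : ι} {l : L} (h : l ∈ P.links p) :
    μ l ≤ P.price μ p :=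
  Finset.single_le_sum (fun l _ => hμ l) h

theorem price_nonneg {μ : L → ℝ} (hμ : 0 ≤ μ) (p : ι) : 0 ≤ P.price μ p :=
  Finset.sum_nonneg fun l _ => hμ l

/-- Division by the positive share `μ l / P.price μ p` turns the capacity multiplier `m` into a
price proportional to the path price. -/
theorem IsLinkSolution.isStationary {μ : L → ℝ} (hμ : 0 ≤ μ) {l : L} (hl : 0 < μ l)
    {r φ : ι → ℝ} {m : ℝ} (h : P.IsLinkSolution l (fun p => P.share μ p l) r m φ)
    {p : ι} (hp : p ∈ P.flows l) :
    P.IsStationary p (m / μ l * P.price μ p) (r p) (φ p) := by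
  have hS : 0 < P.price μ p := hl.trans_le (le_price hμ (mem_flows.1 hp))
  have hα : P.share μ p l = μ l / P.price μ p := rfl
  have h1 := h.stationary p hp
  have h2 := h.sign_slackness p hp
  simp only [hα] at h1 h2
  refine ⟨?_, h.rate_nonneg p hp, h.sign_nonneg p hp, ?_⟩
  · field_simp at h1 ⊢
    linarith
  · rw [mul_assoc] at h2
    exact (mul_eq_zero.1 h2).resolve_left (div_pos hl hS).ne'

theorem IsRun.isStep {μ : ℕ → L → ℝ} {r φ : ℕ → L → ι → ℝ} (h : P.IsRun μ r φ) (j : ℕ) :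
    P.IsStep (μ j) (μ (j + 1)) (r (j + 1)) (φ (j + 1)) := by
  have hnn : ∀ j, 0 ≤ μ j := by
    intro j
    induction j with
    | zero => exact fun l => (h.init l).le
    | succ j ih =>
      intro l
      by_cases hl : 0 < μ j l
      · exact (h.active j l hl).multiplier_nonneg
      · rw [(h.idle j l hl).1]
        exact ih l
  have key : ∀ j l, (∀ p ∈ P.flows l, P.IsStationary p (μ (j + 1) l / μ j l * P.price (μ j) p)
      (r (j + 1) l p) (φ (j + 1) l p)) ∧ P.load (r (j + 1) l) l ≤ P.cap l := by
    intro j l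
    induction j with
    | zero =>
      exact ⟨fun p hp => (h.active 0 l (h.init l)).isStationary (hnn 0) (h.init l) hp,
        (h.active 0 l (h.init l)).capacity⟩
    | succ j ih =>
      by_cases hl : 0 < μ (j + 1) l
      · exact ⟨fun p hp => (h.active _ l hl).isStationary (hnn _) hl hp,
          (h.active _ l hl).capacity⟩
      · have h0 : μ (j + 1) l = 0 := le_antisymm (not_lt.1 hl) (hnn _ l)
        obtain ⟨h1, h2, h3⟩ := h.idle _ l hl
        rw [h1, h2, h3]
        -- An idle link has ratio `0 / 0 = 0`, and the ratio was already `0` when its multiplier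
        -- reached zero, so the stored rates remain stationary at price `0`.
        simpa [h0] using ih
  refine ⟨hnn j, hnn _, fun l => (key j l).1, fun l => (key j l).2, fun l => ?_, fun l hl => ?_⟩
  · by_cases hl : 0 < μ j l
    · exact (h.active j l hl).slackness
    · rw [(h.idle j l hl).1, le_antisymm (not_lt.1 hl) (hnn _ l), zero_mul]
  · rw [(h.idle j l (by simp [hl])).1, hl]

theorem Regular.regret_nonneg (H : P.Regular) (μ : L → ℝ) (p : ι) {x : ℝ}
    (hx : x ∈ Set.Icc 0 P.rateBound) : 0 ≤ P.regret μ p x :=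
  sub_nonneg.2 (H.response_le p _ hx)

theorem Regular.boundedDual_le (H : P.Regular) (μ : L → ℝ) :
    P.boundedDual μ ≤ ∑ p, P.cost p 0 - ∑ l, μ l * P.cap l := by
  unfold boundedDual
  gcongr with p
  simpa [responses] using H.response_le p (P.price μ p) (t := 0) ⟨le_rfl, P.rateBound_pos.le⟩

namespace IsStep

variable {μ μ' : L → ℝ} {r φ : L → ι → ℝ}

theorem rate_le_cap (h : P.IsStep μ μ' r φ) {l : L} {p : ι} (hp : p ∈ P.flows l) :
    r l p ≤ P.cap l :=
  (Finset.single_le_sum (f := r l) (fun q hq => (h.stationary l q hq).rate_nonneg) hp).trans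
    (h.load_le l)

theorem rate_mem (h : P.IsStep μ μ' r φ) {l : L} {p : ι} (hp : p ∈ P.flows l) :
    r l p ∈ Set.Icc 0 P.rateBound :=
  ⟨(h.stationary l p hp).rate_nonneg, (h.rate_le_cap hp).trans (P.cap_lt_rateBound l).le⟩

theorem rate_eq (h : P.IsStep μ μ' r φ) (H : P.Regular) {l : L} {p : ι} (hp : p ∈ P.flows l) :
    r l p = P.response p (μ' l / μ l * P.price μ p) :=
  (h.stationary l p hp).eq_response H (h.rate_mem hp).2

theorem share_nonneg (h : P.IsStep μ μ' r φ) (l : L) (p : ι) : 0 ≤ P.share μ p l :=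
  div_nonneg (h.nonneg l) (price_nonneg h.nonneg p)

theorem share_le_one (h : P.IsStep μ μ' r φ) {l : L} {p : ι} (hp : p ∈ P.flows l) :
    P.share μ p l ≤ 1 :=
  div_le_one_of_le₀ (le_price h.nonneg (mem_flows.1 hp)) (price_nonneg h.nonneg p)

theorem share_mul_price (h : P.IsStep μ μ' r φ) {l : L} {p : ι} (hp : p ∈ P.flows l) :
    P.share μ p l * P.price μ p = μ l := by
  rcases (price_nonneg h.nonneg p).eq_or_lt with h0 | h0
  · have := le_price h.nonneg (mem_flows.1 hp)
    rw [← h0] at this ⊢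
    rw [mul_zero]
    exact le_antisymm (h.nonneg l) this
  · exact div_mul_cancel₀ _ h0.ne'

theorem share_mul_linkPrice (h : P.IsStep μ μ' r φ) {l : L} {p : ι} (hp : p ∈ P.flows l) :
    P.share μ p l * (μ' l / μ l * P.price μ p) = μ' l := by
  rw [mul_left_comm, h.share_mul_price hp]
  rcases eq_or_ne (μ l) 0 with h0 | h0
  · rw [h0, h.idle l h0, mul_zero]
  · exact div_mul_cancel₀ _ h0

theorem slack_nonneg (h : P.IsStep μ μ' r φ) (l : L) :
    0 ≤ (μ l - μ' l) * (P.cap l - P.load (r l) l) := by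
  nlinarith [h.slackness l, mul_nonneg (h.nonneg l) (sub_nonneg.2 (h.load_le l))]

/-- The ascent estimate for a single flow. -/
theorem flow_ascent (h : P.IsStep μ μ' r φ) (H : P.Regular) (p : ι) :
    ∑ l ∈ P.links p, (P.share μ p l * P.regret μ p (r l p) + (μ' l - μ l) * r l p) ≤
      (P.cost p (P.responses μ' p) + P.price μ' p * P.responses μ' p) -
        (P.cost p (P.responses μ p) + P.price μ p * P.responses μ p) := by
  rcases (price_nonneg h.nonneg p).eq_or_lt with h0 | h0
  -- On a path of price zero the shares are `0 / 0 = 0` and do not sum to one; here both sides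
  -- vanish.
  · have hz : ∀ l ∈ P.links p, μ l = 0 := fun l hl =>
      le_antisymm (h0 ▸ le_price h.nonneg hl) (h.nonneg l)
    have hz' : ∀ l ∈ P.links p, μ' l = 0 := fun l hl => h.idle l (hz l hl)
    have hp : P.price μ' p = P.price μ p := by
      rw [← h0]
      exact Finset.sum_eq_zero hz'
    simp only [responses, hp, sub_self]
    refine (Finset.sum_eq_zero fun l hl => ?_).le
    rw [share, hz l hl, hz' l hl]
    ring
  · have hsum : ∑ l ∈ P.links p, P.share μ p l = 1 := by
      simp only [share]
      rw [← Finset.sum_div]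
      exact div_self h0.ne'
    set x' := P.responses μ' p
    set c := P.cost p (P.responses μ p) + P.price μ p * P.responses μ p with hc
    -- The new dual term is distributed over the links of the path; each part is then bounded below
    -- by the optimality of that link's rate at its posted price.
    have e1 : P.cost p x' + P.price μ' p * x' - c =
        ∑ l ∈ P.links p, (P.share μ p l * (P.cost p x' - c) + μ' l * x') := by
      rw [Finset.sum_add_distrib, ← Finset.sum_mul, ← Finset.sum_mul, hsum]
      simp only [price]
      ring
    rw [e1]
    refine Finset.sum_le_sum fun l hl => ?_
    have hp := mem_flows.2 hl
    have h1 := (h.stationary l p hp).eq_response H (h.rate_mem hp).2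
    have h2 := H.response_le p (μ' l / μ l * P.price μ p) (t := x') (H.response_spec p _).1
    rw [← h1] at h2
    have h3 := mul_le_mul_of_nonneg_left h2 (h.share_nonneg l p)
    have hy := h.share_mul_linkPrice hp
    have e2 : ∀ x, P.share μ p l * (P.cost p x + μ' l / μ l * P.price μ p * x) =
        P.share μ p l * P.cost p x + μ' l * x := fun x => by
      rw [mul_add, ← mul_assoc, hy]
    rw [e2, e2] at h3
    have h4 := h.share_mul_price hp
    have h5 : P.share μ p l * P.regret μ p (r l p) =
        P.share μ p l * P.cost p (r l p) + μ l * r l p - P.share μ p l * c := by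
      rw [regret, ← hc, ← h4]
      ring
    rw [h5]
    linarith

theorem ascent (h : P.IsStep μ μ' r φ) (H : P.Regular) :
    ∑ l, (∑ p ∈ P.flows l, P.share μ p l * P.regret μ p (r l p) +
      (μ l - μ' l) * (P.cap l - P.load (r l) l)) ≤ P.boundedDual μ' - P.boundedDual μ := by
  have h1 := Finset.sum_le_sum fun p (_ : p ∈ Finset.univ) => h.flow_ascent H p
  rw [sum_links_comm fun p l => P.share μ p l * P.regret μ p (r l p) + (μ' l - μ l) * r l p,
    Finset.sum_sub_distrib] at h1
  have h2 : ∑ l, (∑ p ∈ P.flows l, P.share μ p l * P.regret μ p (r l p) +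
      (μ l - μ' l) * (P.cap l - P.load (r l) l)) =
      ∑ l, ∑ p ∈ P.flows l, (P.share μ p l * P.regret μ p (r l p) + (μ' l - μ l) * r l p) +
        ∑ l, μ l * P.cap l - ∑ l, μ' l * P.cap l := by
    rw [← Finset.sum_add_distrib, ← Finset.sum_sub_distrib]
    refine Finset.sum_congr rfl fun l _ => ?_
    rw [Finset.sum_add_distrib, ← Finset.mul_sum, load]
    ring
  rw [h2]
  unfold boundedDual
  linarith

theorem regret_term_nonneg (h : P.IsStep μ μ' r φ) (H : P.Regular) {l : L} {p : ι}
    (hp : p ∈ P.flows l) : 0 ≤ P.share μ p l * P.regret μ p (r l p) :=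
  mul_nonneg (h.share_nonneg l p) (H.regret_nonneg μ p (h.rate_mem hp))

theorem link_term_nonneg (h : P.IsStep μ μ' r φ) (H : P.Regular) (l : L) :
    0 ≤ ∑ p ∈ P.flows l, P.share μ p l * P.regret μ p (r l p) +
      (μ l - μ' l) * (P.cap l - P.load (r l) l) :=
  add_nonneg (Finset.sum_nonneg fun _ hp => h.regret_term_nonneg H hp) (h.slack_nonneg l)

theorem link_term_le (h : P.IsStep μ μ' r φ) (H : P.Regular) (l : L) :
    ∑ p ∈ P.flows l, P.share μ p l * P.regret μ p (r l p) +
      (μ l - μ' l) * (P.cap l - P.load (r l) l) ≤ P.boundedDual μ' - P.boundedDual μ :=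
  (Finset.single_le_sum (f := fun l => ∑ p ∈ P.flows l, P.share μ p l * P.regret μ p (r l p) +
    (μ l - μ' l) * (P.cap l - P.load (r l) l)) (fun l _ => h.link_term_nonneg H l)
    (Finset.mem_univ l)).trans (h.ascent H)

theorem boundedDual_le (h : P.IsStep μ μ' r φ) (H : P.Regular) :
    P.boundedDual μ ≤ P.boundedDual μ' :=
  sub_nonneg.1 ((Finset.sum_nonneg fun l _ => h.link_term_nonneg H l).trans (h.ascent H))

theorem regret_term_le (h : P.IsStep μ μ' r φ) (H : P.Regular) {l : L} {p : ι}
    (hp : p ∈ P.flows l) :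
    P.share μ p l * P.regret μ p (r l p) ≤ P.boundedDual μ' - P.boundedDual μ :=
  (Finset.single_le_sum (f := fun p => P.share μ p l * P.regret μ p (r l p))
    (fun _ hp => h.regret_term_nonneg H hp) hp).trans
    ((le_add_of_nonneg_right (h.slack_nonneg l)).trans (h.link_term_le H l))

theorem slack_le (h : P.IsStep μ μ' r φ) (H : P.Regular) (l : L) :
    (μ l - μ' l) * (P.cap l - P.load (r l) l) ≤ P.boundedDual μ' - P.boundedDual μ :=
  (le_add_of_nonneg_left (Finset.sum_nonneg fun _ hp => h.regret_term_nonneg H hp)).trans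
    (h.link_term_le H l)

end IsStep

end

/-! ### Limits of multipliers along ultrafilters -/

section

variable {P}

theorem exists_tendsto_of_mem_Icc {α : Type*} {U : Ultrafilter α} {u : α → ℝ} {a b : ℝ}
    (h : ∀ᶠ j in U, u j ∈ Set.Icc a b) : ∃ x ∈ Set.Icc a b, Tendsto u U (𝓝 x) :=
  isCompact_Icc.ultrafilter_le_nhds (U.map u) (by rw [le_principal_iff]; exact h)

/-- A sequence with vanishing increments and finitely many cluster points converges. -/
theorem exists_tendsto_of_finite {X : Type*} [MetricSpace X] {u : ℕ → X} {F : Set X}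
    (hF : F.Finite) (hstep : Tendsto (fun j => dist (u j) (u (j + 1))) atTop (𝓝 0))
    (hcl : ∀ U : Ultrafilter ℕ, ↑U ≤ (atTop : Filter ℕ) → ∃ x ∈ F, Tendsto u U (𝓝 x)) :
    ∃ x ∈ F, Tendsto u atTop (𝓝 x) := by
  obtain ⟨x₀, hx₀, hU₀⟩ := hcl (hyperfilter ℕ) Nat.hyperfilter_le_atTop
  -- The point `x₀` is isolated in `F`, so any cluster point within `η / 2` of it equals it. Small
  -- steps then cannot leave this ball.
  obtain ⟨η, hη, hball⟩ := Metric.isOpen_iff.1 (hF.subset Set.sdiff_subset).isClosed.isOpen_compl x₀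
    (show x₀ ∈ (F \ {x₀})ᶜ by simp)
  have hlim : ∀ U : Ultrafilter ℕ, ↑U ≤ (atTop : Filter ℕ) →
      (∀ᶠ j in U, dist (u j) x₀ < η / 2) → Tendsto u U (𝓝 x₀) := by
    intro U hU hev
    obtain ⟨x, hx, hxU⟩ := hcl U hU
    have hd : dist x x₀ ≤ η / 2 :=
      le_of_tendsto (hxU.dist tendsto_const_nhds) (hev.mono fun _ h => h.le)
    have hmem := hball (show x ∈ Metric.ball x₀ η from Metric.mem_ball.2 (by linarith))
    have : x = x₀ := by
      by_contra hne
      exact hmem ⟨hx, hne⟩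
    rwa [this] at hxU
  have hinv : ∀ᶠ j in atTop, dist (u j) x₀ < η / 2 → dist (u (j + 1)) x₀ < η / 2 := by
    by_contra hcon
    obtain ⟨U, hU⟩ := exists_ultrafilter_iff.2
      (frequently_mem_iff_neBot.1 (not_eventually.1 hcon))
    obtain ⟨hUle, hUs⟩ := le_inf_iff.1 hU
    replace hUs := le_principal_iff.1 hUs
    have h1 := hlim U hUle (mem_of_superset hUs fun j hj => (Classical.not_imp.1 hj).1)
    have h2 : Tendsto (fun j => u (j + 1)) U (𝓝 x₀) := by
      rw [tendsto_iff_dist_tendsto_zero] at h1 ⊢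
      have h3 := h1.add (hstep.mono_left hUle)
      rw [add_zero] at h3
      refine squeeze_zero (fun _ => dist_nonneg) (fun j => ?_) h3
      linarith [dist_triangle_left (u (j + 1)) x₀ (u j)]
    have h4 := h2.eventually (Metric.ball_mem_nhds x₀ (half_pos hη))
    obtain ⟨j, hj, hj'⟩ := (Filter.Eventually.and hUs h4).exists
    exact (Classical.not_imp.1 hj).2 hj'
  obtain ⟨N, hN⟩ := eventually_atTop.1 hinv
  have hfreq : ∃ n ≥ N, dist (u n) x₀ < η / 2 := by
    obtain ⟨n, hn, hn'⟩ := ((hU₀.eventually (Metric.ball_mem_nhds x₀ (half_pos hη))).and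
      (Nat.hyperfilter_le_atTop (eventually_ge_atTop N))).exists
    exact ⟨n, hn', hn⟩
  obtain ⟨n, hn, hdist⟩ := hfreq
  have hall : ∀ j ≥ n, dist (u j) x₀ < η / 2 := fun j hj =>
    Nat.le_induction hdist (fun k hk ih => hN k (hn.trans hk) ih) j hj
  refine ⟨x₀, hx₀, (tendsto_iff_ultrafilter _ _ _).2 fun U hU => hlim U hU ?_⟩
  exact hU (eventually_atTop.2 ⟨n, hall⟩)

theorem tendsto_price {α : Type*} {F : Filter α} {μ : α → L → ℝ} {μ₀ : L → ℝ}
    (h : Tendsto μ F (𝓝 μ₀)) (p : ι) :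
    Tendsto (fun j => P.price (μ j) p) F (𝓝 (P.price μ₀ p)) :=
  tendsto_finsetSum _ fun l _ => tendsto_pi_nhds.1 h l

theorem load_congr {r r' : ι → ℝ} {l : L} (h : ∀ p ∈ P.flows l, r p = r' p) :
    P.load r l = P.load r' l :=
  Finset.sum_congr rfl h

namespace Regular

theorem tendsto_cost (H : P.Regular) {α : Type*} {F : Filter α} [F.NeBot] {u : α → ℝ} {x : ℝ}
    (p : ι) (hu : ∀ a, u a ∈ Set.Icc 0 P.rateBound) (h : Tendsto u F (𝓝 x)) :
    Tendsto (fun a => P.cost p (u a)) F (𝓝 (P.cost p x)) :=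
  (H.continuousOn_cost p x (isClosed_Icc.mem_of_tendsto h (Eventually.of_forall hu))).tendsto.comp
    (tendsto_nhdsWithin_iff.2 ⟨h, Eventually.of_forall hu⟩)

theorem tendsto_responses (H : P.Regular) {α : Type*} {F : Filter α} {μ : α → L → ℝ} {μ₀ : L → ℝ}
    (h : Tendsto μ F (𝓝 μ₀)) :
    Tendsto (fun j => P.responses (μ j)) F (𝓝 (P.responses μ₀)) :=
  tendsto_pi_nhds.2 fun p => ((H.continuous_response p).tendsto _).comp (tendsto_price h p)

/-- Summed by flows instead of links, the quantity consists of nonpositive terms by monotonicity of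
the responses; hence each term vanishes. -/
theorem responses_eq (H : P.Regular) {μ μ' : L → ℝ}
    (h : 0 ≤ ∑ l, (μ l - μ' l) * (P.load (P.responses μ) l - P.load (P.responses μ') l)) :
    P.responses μ = P.responses μ' := by
  have e : ∑ p, (P.price μ p - P.price μ' p) * (P.responses μ p - P.responses μ' p) =
      ∑ l, (μ l - μ' l) * (P.load (P.responses μ) l - P.load (P.responses μ') l) := by
    have h1 := sum_price_mul (P := P) (μ - μ') (P.responses μ - P.responses μ')
    simpa [price, load, Finset.sum_sub_distrib] using h1
  have hle : ∀ p ∈ Finset.univ,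
      (P.price μ p - P.price μ' p) * (P.responses μ p - P.responses μ' p) ≤ 0 :=
    fun p _ => H.response_mul_nonpos p _ _
  have h0 := (Finset.sum_eq_zero_iff_of_nonpos hle).1
    (le_antisymm (Finset.sum_nonpos hle) (e ▸ h))
  funext p
  rcases mul_eq_zero.1 (h0 p (Finset.mem_univ p)) with h1 | h1
  · rw [responses, responses, sub_eq_zero.1 h1]
  · exact sub_eq_zero.1 h1

end Regular

/-- The rate vectors that solve the problem in which the multipliers of some links are
forced to vanish. -/
def faceResponses (P : RoutingProblem ι L) : Set (ι → ℝ) :=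
  {x | ∃ μ : L → ℝ, 0 ≤ μ ∧ (∀ l, 0 < μ l → P.load (P.responses μ) l = P.cap l) ∧
    P.responses μ = x}

/-- For a fixed support `A`, the loads agree on `A` and the multipliers vanish off `A`, so
`responses_eq` leaves a single rate vector. -/
theorem Regular.finite_faceResponses (H : P.Regular) : P.faceResponses.Finite := by
  have h : P.faceResponses ⊆ ⋃ A : Set L, {x | ∃ μ : L → ℝ, 0 ≤ μ ∧ {l | 0 < μ l} = A ∧
      (∀ l ∈ A, P.load (P.responses μ) l = P.cap l) ∧ P.responses μ = x} := by
    rintro x ⟨μ, h0, h1, h2⟩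
    exact Set.mem_iUnion.2 ⟨{l | 0 < μ l}, μ, h0, rfl, h1, h2⟩
  refine (Set.finite_iUnion fun A => Set.Subsingleton.finite ?_).subset h
  rintro _ ⟨μ, h0, h1, h2, rfl⟩ _ ⟨μ', h0', h1', h2', rfl⟩
  refine H.responses_eq (Finset.sum_nonneg fun l _ => le_of_eq ?_)
  by_cases hl : l ∈ A
  · rw [h2 l hl, h2' l hl, sub_self, mul_zero]
  · have e1 : μ l = 0 := le_antisymm (not_lt.1 fun h => hl (h1 ▸ h)) (h0 l)
    have e2 : μ' l = 0 := le_antisymm (not_lt.1 fun h => hl (h1' ▸ h)) (h0' l)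
    rw [e1, e2, sub_self, zero_mul]

/-- Infinitely many iterations of the algorithm. -/
def IsTrajectory (P : RoutingProblem ι L) (μ : ℕ → L → ℝ) (r φ : ℕ → L → ι → ℝ) : Prop :=
  ∀ j, P.IsStep (μ j) (μ (j + 1)) (r (j + 1)) (φ (j + 1))

namespace IsTrajectory

variable {μ : ℕ → L → ℝ} {r φ : ℕ → L → ι → ℝ}

theorem monotone_boundedDual (h : P.IsTrajectory μ r φ) (H : P.Regular) :
    Monotone fun j => P.boundedDual (μ j) :=
  monotone_nat_of_le_succ fun j => (h j).boundedDual_le H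

theorem sum_mul_cap_le (h : P.IsTrajectory μ r φ) (H : P.Regular) (j : ℕ) :
    ∑ l, μ j l * P.cap l ≤ ∑ p, P.cost p 0 - P.boundedDual (μ 0) := by
  have h1 := h.monotone_boundedDual H (Nat.zero_le j)
  have h2 := H.boundedDual_le (μ j)
  simp only at h1
  linarith

theorem exists_bound (h : P.IsTrajectory μ r φ) (H : P.Regular) (l : L) :
    ∃ M, ∀ j, μ j l ∈ Set.Icc 0 M := by
  refine ⟨(∑ p, P.cost p 0 - P.boundedDual (μ 0)) / P.cap l, fun j => ⟨(h j).nonneg l, ?_⟩⟩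
  rw [le_div_iff₀ (H.cap_pos l)]
  exact (Finset.single_le_sum (f := fun l => μ j l * P.cap l)
    (fun l _ => mul_nonneg ((h j).nonneg l) (H.cap_pos l).le) (Finset.mem_univ l)).trans
    (h.sum_mul_cap_le H j)

theorem tendsto_gain (h : P.IsTrajectory μ r φ) (H : P.Regular) :
    Tendsto (fun j => P.boundedDual (μ (j + 1)) - P.boundedDual (μ j)) atTop (𝓝 0) := by
  have hb : BddAbove (Set.range fun j => P.boundedDual (μ j)) := by
    refine ⟨∑ p, P.cost p 0, ?_⟩
    rintro _ ⟨j, rfl⟩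
    have h2 := H.boundedDual_le (μ j)
    have h3 : 0 ≤ ∑ l, μ j l * P.cap l := Finset.sum_nonneg fun l _ =>
      mul_nonneg ((h j).nonneg l) (H.cap_pos l).le
    simp only
    linarith
  have h1 := tendsto_atTop_ciSup (h.monotone_boundedDual H) hb
  simpa using ((tendsto_add_atTop_iff_nat 1).2 h1).sub h1

/-- Share times regret is squeezed by the vanishing dual gain; if the share stays positive, the
limit rate has zero regret. -/
theorem eq_responses_of_tendsto (h : P.IsTrajectory μ r φ) (H : P.Regular) {U : Ultrafilter ℕ}
    (hU : ↑U ≤ (atTop : Filter ℕ)) {m : L → ℝ} (hm : Tendsto μ U (𝓝 m)) {l : L} {p : ι}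
    (hp : p ∈ P.flows l) {a x : ℝ} (ha : Tendsto (fun j => P.share (μ j) p l) U (𝓝 a))
    (ha0 : 0 < a) (hx : Tendsto (fun j => r (j + 1) l p) U (𝓝 x)) :
    x = P.responses m p := by
  have hmem : ∀ j, r (j + 1) l p ∈ Set.Icc 0 P.rateBound := fun j => (h j).rate_mem hp
  have h1 : Tendsto (fun j => P.share (μ j) p l * P.regret (μ j) p (r (j + 1) l p)) U (𝓝 0) :=
    squeeze_zero (fun j => (h j).regret_term_nonneg H hp) (fun j => (h j).regret_term_le H hp)
      ((h.tendsto_gain H).mono_left hU)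
  have hX := tendsto_pi_nhds.1 (H.tendsto_responses hm) p
  have hS := tendsto_price (P := P) hm p
  have h2 : Tendsto (fun j => P.regret (μ j) p (r (j + 1) l p)) U (𝓝 (P.regret m p x)) :=
    ((H.tendsto_cost p hmem hx).add (hS.mul hx)).sub
      ((H.tendsto_cost p (fun j => (H.response_spec p _).1) hX).add (hS.mul hX))
  have h3 : P.regret m p x = 0 :=
    (mul_eq_zero.1 (tendsto_nhds_unique (ha.mul h2) h1)).resolve_left ha0.ne'
  refine H.eq_response (isClosed_Icc.mem_of_tendsto hx (Eventually.of_forall hmem))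
    fun t ht => ?_
  have h4 := H.response_le p (P.price m p) ht
  have h5 := sub_eq_zero.1 h3
  rw [h5]
  exact h4

/-- Consecutive multipliers of a link have the same limits, and the capacity is exhausted where
the limit is positive. -/
theorem link_limit (h : P.IsTrajectory μ r φ) (H : P.Regular) {U : Ultrafilter ℕ}
    (hU : ↑U ≤ (atTop : Filter ℕ)) {m m' : L → ℝ} (hm : Tendsto μ U (𝓝 m))
    (hm' : Tendsto (fun j => μ (j + 1)) U (𝓝 m')) (l : L) :
    m l = m' l ∧ (0 < m l → P.load (P.responses m) l = P.cap l) := by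
  have hml := tendsto_pi_nhds.1 hm l
  have hml' := tendsto_pi_nhds.1 hm' l
  have hm0 : 0 ≤ m l := ge_of_tendsto' hml fun j => (h j).nonneg l
  have hm0' : 0 ≤ m' l := ge_of_tendsto' hml' fun j => (h j).nonneg' l
  rcases (add_nonneg hm0 hm0').eq_or_lt with hz | hpos
  · exact ⟨by linarith, fun h => by linarith⟩
  -- By slackness the new multiplier times the slack is zero, so the difference of multipliers may
  -- be replaced by their sum, whose limit is positive.
  have hslack : Tendsto (fun j => P.cap l - P.load (r (j + 1) l) l) U (𝓝 0) := by
    have h1 : Tendsto (fun j => (μ j l - μ (j + 1) l) * (P.cap l - P.load (r (j + 1) l) l))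
        U (𝓝 0) :=
      squeeze_zero (fun j => (h j).slack_nonneg l) (fun j => (h j).slack_le H l)
        ((h.tendsto_gain H).mono_left hU)
    have hs := hml.add hml'
    have h2 := h1.div hs hpos.ne'
    rw [zero_div] at h2
    refine h2.congr' ?_
    filter_upwards [hs.eventually (lt_mem_nhds hpos)] with j hj
    rw [Pi.div_apply, div_eq_iff hj.ne']
    have := (h j).slackness l
    linear_combination 2 * this
  have hr : ∀ p, ∃ x, p ∈ P.flows l → Tendsto (fun j => r (j + 1) l p) U (𝓝 x) := by
    intro p
    by_cases hp : p ∈ P.flows l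
    · obtain ⟨x, -, hx⟩ := exists_tendsto_of_mem_Icc (U := U) (u := fun j => r (j + 1) l p)
        (Eventually.of_forall fun j => (h j).rate_mem hp)
      exact ⟨x, fun _ => hx⟩
    · exact ⟨0, fun h => absurd h hp⟩
  choose x hx using hr
  have hload : P.load x l = P.cap l := by
    have h1 : Tendsto (fun j => P.load (r (j + 1) l) l) U (𝓝 (P.load x l)) :=
      tendsto_finsetSum _ hx
    have h2 := tendsto_nhds_unique (h1.const_sub (P.cap l)) hslack
    linarith
  have hx0 : ∀ p ∈ P.flows l, 0 ≤ x p := fun p hp =>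
    ge_of_tendsto' (hx p hp) fun j => ((h j).rate_mem hp).1
  have hxlt : ∀ p ∈ P.flows l, x p < P.rateBound := fun p hp =>
    (le_of_tendsto' (hx p hp) fun j => (h j).rate_le_cap hp).trans_lt (P.cap_lt_rateBound l)
  have hshare : ∀ p ∈ P.flows l, ∃ a ∈ Set.Icc (0 : ℝ) 1,
      Tendsto (fun j => P.share (μ j) p l) U (𝓝 a) := fun p hp =>
    exists_tendsto_of_mem_Icc (Eventually.of_forall fun j =>
      ⟨(h j).share_nonneg l p, (h j).share_le_one hp⟩)
  have hS := fun p => tendsto_price (P := P) hm p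
  constructor
  · obtain ⟨p, hp, hxp⟩ : ∃ p ∈ P.flows l, 0 < x p := by
      by_contra! hcon
      have := Finset.sum_nonpos hcon
      exact absurd (hload ▸ this) (not_le.2 (H.cap_pos l))
    obtain ⟨a, ⟨ha0, -⟩, ha⟩ := hshare p hp
    -- A positive rate forces the posted price below minus the marginal cost at `0`, so posted
    -- prices are bounded.
    obtain ⟨y, -, hy⟩ : ∃ y ∈ Set.Icc 0 (-derivWithin (P.cost p) P.dom 0),
        Tendsto (fun j => μ (j + 1) l / μ j l * P.price (μ j) p) U (𝓝 y) := by
      refine exists_tendsto_of_mem_Icc ?_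
      filter_upwards [(hx p hp).eventually (lt_mem_nhds hxp)] with j hj
      refine ⟨mul_nonneg (div_nonneg ((h j).nonneg' l) ((h j).nonneg l))
        (price_nonneg (h j).nonneg p), ?_⟩
      by_contra! hlt
      rw [(h j).rate_eq H hp, H.response_eq_zero hlt.le] at hj
      exact hj.false
    have e1 : a * P.price m p = m l := tendsto_nhds_unique
      ((ha.mul (hS p)).congr fun j => (h j).share_mul_price hp) hml
    have e2 : a * y = m' l := tendsto_nhds_unique
      ((ha.mul hy).congr fun j => (h j).share_mul_linkPrice hp) hml'
    have hapos : 0 < a := by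
      refine ha0.lt_of_ne fun h0 => ?_
      rw [← h0, zero_mul] at e1 e2
      linarith
    have f1 : x p = P.response p (P.price m p) := h.eq_responses_of_tendsto H hU hm hp ha hapos
      (hx p hp)
    have f2 : x p = P.response p y := tendsto_nhds_unique (hx p hp)
      ((((H.continuous_response p).tendsto y).comp hy).congr fun j => ((h j).rate_eq H hp).symm)
    -- The same positive rate answers both the path price and the posted price, so these agree in
    -- the limit; multiplied by the share they are `m l` and `m' l`.
    have f3 : P.price m p = y := H.eq_of_response_eq (f1 ▸ hxp) (f1 ▸ hxlt p hp) (f1 ▸ f2)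
    rw [← e1, ← e2, f3]
  · intro hpos
    rw [← hload]
    refine load_congr fun p hp => ?_
    obtain ⟨a, ⟨ha0, -⟩, ha⟩ := hshare p hp
    have e1 : a * P.price m p = m l := tendsto_nhds_unique
      ((ha.mul (hS p)).congr fun j => (h j).share_mul_price hp) hml
    have hapos : 0 < a := by
      refine ha0.lt_of_ne fun h0 => ?_
      rw [← h0, zero_mul] at e1
      linarith
    exact (h.eq_responses_of_tendsto H hU hm hp ha hapos (hx p hp)).symm

theorem exists_limit (h : P.IsTrajectory μ r φ) (H : P.Regular) {U : Ultrafilter ℕ}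
    (hU : ↑U ≤ (atTop : Filter ℕ)) :
    ∃ m : L → ℝ, 0 ≤ m ∧ Tendsto μ U (𝓝 m) ∧ Tendsto (fun j => μ (j + 1)) U (𝓝 m) ∧
      ∀ l, 0 < m l → P.load (P.responses m) l = P.cap l := by
  have h1 : ∀ l, ∃ x, Tendsto (fun j => μ j l) U (𝓝 x) := fun l => by
    obtain ⟨M, hM⟩ := h.exists_bound H l
    obtain ⟨x, -, hx⟩ := exists_tendsto_of_mem_Icc (U := U) (Eventually.of_forall hM)
    exact ⟨x, hx⟩
  have h2 : ∀ l, ∃ x, Tendsto (fun j => μ (j + 1) l) U (𝓝 x) := fun l => by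
    obtain ⟨M, hM⟩ := h.exists_bound H l
    obtain ⟨x, -, hx⟩ := exists_tendsto_of_mem_Icc (U := U)
      (Eventually.of_forall fun j => hM (j + 1))
    exact ⟨x, hx⟩
  choose m hm using h1
  choose m' hm' using h2
  have key := h.link_limit H hU (tendsto_pi_nhds.2 hm) (tendsto_pi_nhds.2 hm')
  have e : m = m' := funext fun l => (key l).1
  exact ⟨m, fun l => ge_of_tendsto' (hm l) fun j => (h j).nonneg l, tendsto_pi_nhds.2 hm,
    e ▸ tendsto_pi_nhds.2 hm', fun l => (key l).2⟩

theorem tendsto_diff (h : P.IsTrajectory μ r φ) (H : P.Regular) :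
    Tendsto (fun j => μ (j + 1) - μ j) atTop (𝓝 0) := by
  rw [tendsto_iff_ultrafilter]
  intro U hU
  obtain ⟨m, -, h1, h2, -⟩ := h.exists_limit H hU
  simpa using h2.sub h1

end IsTrajectory

end

/-! ### Equilibria and saddle points -/

section

variable {P}

/-- Multipliers that, together with the responses of the flows, satisfy the optimality
conditions of the routing problem. -/
structure IsEquilibrium (P : RoutingProblem ι L) (m : L → ℝ) : Prop where
  nonneg : 0 ≤ m
  load_le : ∀ l, P.load (P.responses m) l ≤ P.cap l
  slackness : ∀ l, m l * (P.load (P.responses m) l - P.cap l) = 0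

/-- A saddle point of the Lagrangian. -/
structure IsSaddle (P : RoutingProblem ι L) (r : ι → ℝ) (μ : L → ℝ) (φ : ι → ℝ) : Prop where
  nonneg : 0 ≤ μ
  sign_nonneg : 0 ≤ φ
  feasible : P.IsFeasible r
  slackness : ∀ l, μ l * (P.load r l - P.cap l) = 0
  sign_slackness : ∀ p, φ p * r p = 0
  le : ∀ p, ∀ t ∈ P.dom,
    P.cost p (r p) + (P.price μ p - φ p) * r p ≤ P.cost p t + (P.price μ p - φ p) * t

theorem lagrangian_eq (r : ι → ℝ) (μ : L → ℝ) (φ : ι → ℝ) :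
    P.lagrangian r μ φ =
      ∑ p, (P.cost p (r p) + (P.price μ p - φ p) * r p) - ∑ l, μ l * P.cap l := by
  have := sum_price_mul (P := P) μ r
  simp only [lagrangian, sub_mul, mul_sub, Finset.sum_add_distrib, Finset.sum_sub_distrib]
  linarith

theorem IsFeasible.lagrangian_le {r : ι → ℝ} (h : P.IsFeasible r) {μ : L → ℝ} {φ : ι → ℝ}
    (hμ : 0 ≤ μ) (hφ : 0 ≤ φ) : P.lagrangian r μ φ ≤ P.objective r := by
  have h1 : ∑ l, μ l * (P.load r l - P.cap l) ≤ 0 := Finset.sum_nonpos fun l _ =>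
    mul_nonpos_of_nonneg_of_nonpos (hμ l) (sub_nonpos.2 (h.1 l))
  have h2 : 0 ≤ ∑ p, φ p * r p := Finset.sum_nonneg fun p _ => mul_nonneg (hφ p) (h.2 p)
  unfold lagrangian objective
  linarith

namespace IsSaddle

variable {r : ι → ℝ} {μ : L → ℝ} {φ : ι → ℝ}

theorem lagrangian_eq_objective (h : P.IsSaddle r μ φ) : P.lagrangian r μ φ = P.objective r := by
  simp [lagrangian, objective, h.slackness, h.sign_slackness]

theorem objective_le (h : P.IsSaddle r μ φ) {r' : ι → ℝ} (hr' : ∀ p, r' p ∈ P.dom) :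
    P.objective r ≤ P.lagrangian r' μ φ := by
  rw [← h.lagrangian_eq_objective, lagrangian_eq, lagrangian_eq]
  exact sub_le_sub_right (Finset.sum_le_sum fun p _ => h.le p _ (hr' p)) _

theorem isPrimalOptimal (h : P.IsSaddle r μ φ) (H : P.Regular) : P.IsPrimalOptimal r :=
  ⟨h.feasible, fun _ hr' => (h.objective_le fun p => H.mem_dom (hr'.2 p)).trans
    (hr'.lagrangian_le h.nonneg h.sign_nonneg)⟩

theorem mem_dualSolutions (h : P.IsSaddle r μ φ) (H : P.Regular) :
    (μ, φ) ∈ P.dualSolutions := by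
  refine ⟨h.nonneg, h.sign_nonneg, fun μ' φ' hμ' hφ' => ?_⟩
  calc P.dualFunction μ' φ' ≤ (P.lagrangian r μ' φ' : EReal) :=
        iInf₂_le r fun p => H.mem_dom (h.feasible.2 p)
    _ ≤ (P.objective r : EReal) := EReal.coe_le_coe_iff.2 (h.feasible.lagrangian_le hμ' hφ')
    _ ≤ P.dualFunction μ φ := le_iInf₂ fun r' hr' => EReal.coe_le_coe_iff.2 (h.objective_le hr')

end IsSaddle

namespace IsEquilibrium

variable {m m' : L → ℝ}

theorem responses_eq (h : P.IsEquilibrium m) (h' : P.IsEquilibrium m') (H : P.Regular) :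
    P.responses m = P.responses m' := by
  refine H.responses_eq (Finset.sum_nonneg fun l _ => ?_)
  nlinarith [h.slackness l, h'.slackness l, mul_nonneg (h.nonneg l) (sub_nonneg.2 (h'.load_le l)),
    mul_nonneg (h'.nonneg l) (sub_nonneg.2 (h.load_le l))]

theorem feasible (h : P.IsEquilibrium m) (H : P.Regular) : P.IsFeasible (P.responses m) :=
  ⟨h.load_le, fun p => H.response_nonneg p _⟩

theorem responses_lt (h : P.IsEquilibrium m) (H : P.Regular) (p : ι) :
    P.responses m p < P.rateBound := by
  obtain ⟨l, hl⟩ := H.links_nonempty p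
  exact ((Finset.single_le_sum (f := P.responses m) (fun q _ => H.response_nonneg q _)
    (mem_flows.2 hl)).trans (h.load_le l)).trans_lt (P.cap_lt_rateBound l)

/-- Feasibility keeps the responses below `rateBound`, so they satisfy the stationarity conditions
of the untruncated problem. -/
theorem exists_isSaddle (h : P.IsEquilibrium m) (H : P.Regular) :
    ∃ φ, P.IsSaddle (P.responses m) m φ := by
  have hst := fun p => H.isStationary_response (h.responses_lt H p)
  exact ⟨_, h.nonneg, fun p => (hst p).sign_nonneg, h.feasible H, h.slackness,
    fun p => (mul_comm _ _).trans (hst p).slackness, fun p t ht => (hst p).le H ht⟩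

end IsEquilibrium

/-! ### Convergence to equilibria -/

/-- The multiplier of an overloaded link increases. -/
theorem IsStep.lt_of_cap_lt_load {μ μ' : L → ℝ} {r φ : L → ι → ℝ} (h : P.IsStep μ μ' r φ)
    (H : P.Regular) {l : L} (hl : P.cap l < P.load (P.responses μ) l) : μ l < μ' l := by
  by_contra! hle
  refine absurd (hl.trans_le ((Finset.sum_le_sum fun p hp => ?_).trans (h.load_le l)))
    (lt_irrefl _)
  -- A ratio of at most one would post prices below the path prices, hence rates at least as large
  -- as the overloading responses.
  rw [h.rate_eq H hp]
  exact H.antitone_response p (mul_le_of_le_one_left (price_nonneg h.nonneg p)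
    (div_le_one_of_le₀ hle (h.nonneg l)))

namespace IsTrajectory

variable {μ : ℕ → L → ℝ} {r φ : ℕ → L → ι → ℝ}

theorem exists_tendsto_responses (h : P.IsTrajectory μ r φ) (H : P.Regular) :
    ∃ X, Tendsto (fun j => P.responses (μ j)) atTop (𝓝 X) := by
  have hstep : Tendsto (fun j => dist (P.responses (μ j)) (P.responses (μ (j + 1)))) atTop
      (𝓝 0) := by
    rw [tendsto_iff_ultrafilter]
    intro U hU
    obtain ⟨m, -, h1, h2, -⟩ := h.exists_limit H hU
    simpa using (H.tendsto_responses h1).dist (H.tendsto_responses h2)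
  obtain ⟨X, -, hX⟩ := exists_tendsto_of_finite H.finite_faceResponses hstep fun U hU => by
    obtain ⟨m, h0, h1, -, h3⟩ := h.exists_limit H hU
    exact ⟨_, ⟨m, h0, h3, rfl⟩, H.tendsto_responses h1⟩
  exact ⟨X, hX⟩

theorem exists_isEquilibrium (h : P.IsTrajectory μ r φ) (H : P.Regular) {U : Ultrafilter ℕ}
    (hU : ↑U ≤ (atTop : Filter ℕ)) :
    ∃ m, P.IsEquilibrium m ∧ Tendsto μ U (𝓝 m) ∧ Tendsto (fun j => μ (j + 1)) U (𝓝 m) := by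
  obtain ⟨m, h0, h1, h2, h3⟩ := h.exists_limit H hU
  obtain ⟨X, hX⟩ := h.exists_tendsto_responses H
  have hXm : X = P.responses m :=
    tendsto_nhds_unique (hX.mono_left hU) (H.tendsto_responses h1)
  have hle : ∀ l, P.load (P.responses m) l ≤ P.cap l := by
    intro l
    by_contra! hlt
    have hload : Tendsto (fun j => P.load (P.responses (μ j)) l) atTop
        (𝓝 (P.load (P.responses m) l)) := by
      rw [hXm] at hX
      exact tendsto_finsetSum _ fun p _ => tendsto_pi_nhds.1 hX p
    obtain ⟨N, hN⟩ := eventually_atTop.1 (hload.eventually (lt_mem_nhds hlt))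
    have hinc : ∀ j ≥ N + 1, μ (N + 1) l ≤ μ j l := fun j hj =>
      Nat.le_induction le_rfl (fun k hk ih =>
        ih.trans ((h k).lt_of_cap_lt_load H (hN k (by omega))).le) j hj
    have hpos : 0 < μ (N + 1) l :=
      ((h N).nonneg l).trans_lt ((h N).lt_of_cap_lt_load H (hN N le_rfl))
    have hml : μ (N + 1) l ≤ m l := ge_of_tendsto (tendsto_pi_nhds.1 h1 l)
      (hU (eventually_atTop.2 ⟨N + 1, hinc⟩))
    exact hlt.ne' (h3 l (hpos.trans_le hml))
  refine ⟨m, ⟨h0, hle, fun l => ?_⟩, h1, h2⟩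
  rcases (h0 l).eq_or_lt with hz | hz
  · rw [← hz, Pi.zero_apply, zero_mul]
  · rw [h3 l hz, sub_self, mul_zero]

/-- The multiplier of a link cannot grow by arbitrarily large factors. -/
theorem exists_ratio_bound (h : P.IsTrajectory μ r φ) (H : P.Regular) {U : Ultrafilter ℕ}
    {m : L → ℝ} (hm : P.IsEquilibrium m) (hμ : Tendsto μ U (𝓝 m)) (l : L) :
    ∃ M, ∀ᶠ j in U, μ (j + 1) l / μ j l ≤ M := by
  by_contra! hcon
  -- Along an ultrafilter, unbounded ratios diverge, so flows of positive limit price are priced out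
  -- of the link.
  have hinf : Tendsto (fun j => μ (j + 1) l / μ j l) U atTop := by
    refine tendsto_atTop.2 fun M => ?_
    exact (hcon M).mono fun j hj => hj.le
  have hzero : ∀ p ∈ P.flows l, 0 < P.price m p → ∀ᶠ j in U, r (j + 1) l p = 0 := by
    intro p hp hpos
    have h1 := hinf.atTop_mul_pos hpos (tendsto_price (P := P) hμ p)
    filter_upwards [h1.eventually_ge_atTop (-derivWithin (P.cost p) P.dom 0)] with j hj
    rw [(h j).rate_eq H hp, H.response_eq_zero hj]
  have hall : ∀ᶠ j in U, ∀ p ∈ P.flows l, 0 < P.price m p → r (j + 1) l p = 0 := by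
    refine (Finset.eventually_all _).2 fun p hp => ?_
    by_cases hpos : 0 < P.price m p
    · exact (hzero p hp hpos).mono fun _ h _ => h
    · exact Eventually.of_forall fun _ h => absurd h hpos
  obtain ⟨j, hj, hρ⟩ := (hall.and (hinf.eventually_gt_atTop 0)).exists
  have hμj : 0 < μ j l := ((h j).nonneg l).lt_of_ne fun h0 => by simp [← h0] at hρ
  have hμj' : 0 < μ (j + 1) l := by
    have := mul_pos hρ hμj
    rwa [div_mul_cancel₀ _ hμj.ne'] at this
  have hload : P.load (r (j + 1) l) l = P.cap l :=
    sub_eq_zero.1 ((mul_eq_zero.1 ((h j).slackness l)).resolve_left hμj'.ne')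
  have hfree : ∀ p, ¬ 0 < P.price m p → P.responses m p = P.response p 0 := fun p hp => by
    rw [responses, le_antisymm (not_lt.1 hp) (price_nonneg hm.nonneg p)]
  have hprice : ∀ p ∈ P.flows l, 0 < μ (j + 1) l / μ j l * P.price (μ j) p := fun p hp =>
    mul_pos hρ (hμj.trans_le (le_price (h j).nonneg (mem_flows.1 hp)))
  have hle : ∀ p ∈ P.flows l, r (j + 1) l p ≤ P.responses m p := by
    intro p hp
    by_cases hpos : 0 < P.price m p
    · rw [hj p hp hpos]
      exact H.response_nonneg p _
    · rw [hfree p hpos, (h j).rate_eq H hp]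
      exact H.antitone_response p (hprice p hp).le
  -- The link is saturated by rates that are at most the equilibrium rates, whose load respects the
  -- capacity; hence equality for every flow. A flow with positive rate then responds alike to price
  -- `0` and to a positive price.
  have heq : ∀ p ∈ P.flows l, r (j + 1) l p = P.responses m p :=
    (Finset.sum_eq_sum_iff_of_le hle).1
      (le_antisymm (Finset.sum_le_sum hle) ((hm.load_le l).trans hload.ge))
  obtain ⟨p, hp, hrp⟩ : ∃ p ∈ P.flows l, 0 < r (j + 1) l p := by
    by_contra! hcon
    have := Finset.sum_nonpos hcon
    exact absurd (hload ▸ this) (not_le.2 (H.cap_pos l))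
  by_cases hpos : 0 < P.price m p
  · exact hrp.ne' (hj p hp hpos)
  · have e1 := heq p hp
    rw [hfree p hpos] at e1
    have e2 := (h j).rate_eq H hp
    have hlt := hm.responses_lt H p
    rw [← heq p hp] at hlt
    exact (hprice p hp).ne' (H.eq_of_response_eq (e2 ▸ hrp) (e2 ▸ hlt) (e2 ▸ e1))

/-- The price that a link with a non-negligible multiplier imputes to a path converges to the
limit price of the path. -/
theorem tendsto_linkPrice (h : P.IsTrajectory μ r φ) (H : P.Regular) {U : Ultrafilter ℕ}
    {m : L → ℝ} (hm : P.IsEquilibrium m) (hμ : Tendsto μ U (𝓝 m))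
    (hμ' : Tendsto (fun j => μ (j + 1)) U (𝓝 m)) {p : ι} {l : L} {δ : ℝ} (hδ : 0 < δ)
    (hsel : ∀ᶠ j in U, δ * P.price (μ (j + 1)) p ≤ μ (j + 1) l) :
    Tendsto (fun j => μ (j + 1) l / μ j l * P.price (μ j) p) U (𝓝 (P.price m p)) := by
  have hS := tendsto_price (P := P) hμ p
  rcases (price_nonneg hm.nonneg p).eq_or_lt with h0 | h0
  · obtain ⟨M, hM⟩ := h.exists_ratio_bound H hm hμ l
    rw [← h0] at hS ⊢
    have h1 := hS.const_mul M
    rw [mul_zero] at h1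
    refine tendsto_of_tendsto_of_tendsto_of_le_of_le' tendsto_const_nhds h1 ?_ ?_
    · exact Eventually.of_forall fun j => mul_nonneg (div_nonneg ((h j).nonneg' l)
        ((h j).nonneg l)) (price_nonneg (h j).nonneg p)
    · filter_upwards [hM] with j hj
      exact mul_le_mul_of_nonneg_right hj (price_nonneg (h j).nonneg p)
  -- The readout condition passes to the limit and makes the link's multiplier positive, so its
  -- ratio tends to one.
  · have hl : 0 < m l := (mul_pos hδ h0).trans_le (le_of_tendsto_of_tendsto
      ((tendsto_price (P := P) hμ' p).const_mul δ) (tendsto_pi_nhds.1 hμ' l) hsel)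
    have h1 := ((tendsto_pi_nhds.1 hμ' l).div (tendsto_pi_nhds.1 hμ l) hl.ne').mul hS
    rwa [div_self hl.ne', one_mul] at h1

theorem exists_readout_limit (h : P.IsTrajectory μ r φ) (H : P.Regular) {s : ℕ → ι → L}
    (hs : P.IsReadout μ s) {U : Ultrafilter ℕ} (hU : ↑U ≤ (atTop : Filter ℕ)) :
    ∃ m f, P.IsEquilibrium m ∧ P.IsSaddle (P.responses m) m f ∧
      Tendsto (fun j => μ (j + 1)) U (𝓝 m) ∧
      Tendsto (fun j p => r (j + 1) (s (j + 1) p) p) U (𝓝 (P.responses m)) ∧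
      Tendsto (fun j p => φ (j + 1) (s (j + 1) p) p) U (𝓝 f) := by
  obtain ⟨m, hm, hμ, hμ'⟩ := h.exists_isEquilibrium H hU
  obtain ⟨hlinks, δ, hδ, hsel⟩ := hs
  have key : ∀ p, ∃ c, Tendsto (fun j => r (j + 1) (s (j + 1) p) p) U (𝓝 (P.responses m p)) ∧
      Tendsto (fun j => φ (j + 1) (s (j + 1) p) p) U (𝓝 c) ∧ 0 ≤ c ∧
      c * P.responses m p = 0 ∧ ∀ t ∈ P.dom,
        P.cost p (P.responses m p) + (P.price m p - c) * P.responses m p ≤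
          P.cost p t + (P.price m p - c) * t := by
    intro p
    -- A path has finitely many links, so the ultrafilter fixes the selected one.
    obtain ⟨l, hl⟩ : ∃ l ∈ P.links p, ∀ᶠ j in U, s (j + 1) p = l :=
      (Ultrafilter.eventually_exists_mem_iff (P.links p).finite_toSet
        (P := fun l j => s (j + 1) p = l)).1 (Eventually.of_forall fun j => ⟨_, hlinks _ p, rfl⟩)
    obtain ⟨hlp, hl⟩ := hl
    have hp := mem_flows.2 hlp
    have hy := h.tendsto_linkPrice H hm hμ hμ' (p := p) (l := l) hδ
      (hl.mono fun j hj => hj ▸ hsel (j + 1) p)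
    have hr : Tendsto (fun j => r (j + 1) l p) U (𝓝 (P.responses m p)) :=
      (((H.continuous_response p).tendsto _).comp hy).congr fun j => ((h j).rate_eq H hp).symm
    -- The sign multiplier is zero unless the rate is, in which case it is the marginal cost at `0`
    -- plus a convergent posted price.
    obtain ⟨c, hc, hφ⟩ : ∃ c ∈ Set.Icc 0 (P.price m p + 1 + |derivWithin (P.cost p) P.dom 0|),
        Tendsto (fun j => φ (j + 1) l p) U (𝓝 c) := by
      refine exists_tendsto_of_mem_Icc ?_
      filter_upwards [hy.eventually (gt_mem_nhds (lt_add_one _))] with j hj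
      have hst := (h j).stationary l p hp
      refine ⟨hst.sign_nonneg, ?_⟩
      rcases mul_eq_zero.1 hst.slackness with h0 | h0
      · have := hst.deriv_eq
        rw [h0] at this
        linarith [le_abs_self (derivWithin (P.cost p) P.dom 0)]
      · rw [h0]
        linarith [abs_nonneg (derivWithin (P.cost p) P.dom 0), price_nonneg hm.nonneg (P := P) p]
    refine ⟨c, hr.congr' (hl.mono fun j hj => by simp only [hj]),
      hφ.congr' (hl.mono fun j hj => by simp only [hj]), hc.1, ?_, fun t ht => ?_⟩
    · refine tendsto_nhds_unique ((hφ.mul hr).congr fun j => ?_) tendsto_const_nhds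
      rw [mul_comm]
      exact ((h j).stationary l p hp).slackness
    · exact le_of_tendsto_of_tendsto' ((H.tendsto_cost p (fun j => (h j).rate_mem hp) hr).add
        ((hy.sub hφ).mul hr)) (((hy.sub hφ).mul_const t).const_add _)
        fun j => ((h j).stationary l p hp).le H ht
  choose f h1 h2 h3 h4 h5 using key
  exact ⟨m, f, hm, ⟨hm.nonneg, h3, hm.feasible H, hm.slackness, h4, h5⟩, hμ',
    tendsto_pi_nhds.2 h1, tendsto_pi_nhds.2 h2⟩

end IsTrajectory

/-! ### Existence of readouts, runs and equilibria -/

theorem Regular.exists_isReadout (H : P.Regular) {μ : ℕ → L → ℝ} (hμ : ∀ j, 0 ≤ μ j) :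
    ∃ s, P.IsReadout μ s := by
  choose s hs hmax using fun j p => (P.links p).exists_max_image (μ j) (H.links_nonempty p)
  have hc : (0 : ℝ) < Fintype.card L + 1 := by positivity
  refine ⟨s, hs, (Fintype.card L + 1 : ℝ)⁻¹, inv_pos.2 hc, fun j p => ?_⟩
  rw [inv_mul_le_iff₀ hc]
  calc ∑ l ∈ P.links p, μ j l ≤ (P.links p).card • μ j (s j p) :=
        Finset.sum_le_card_nsmul _ _ _ (hmax j p)
    _ = (P.links p).card * μ j (s j p) := nsmul_eq_mul _ _
    _ ≤ (Fintype.card L + 1) * μ j (s j p) := by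
        refine mul_le_mul_of_nonneg_right ?_ (hμ j _)
        have : ((P.links p).card : ℝ) ≤ Fintype.card L := by
          exact_mod_cast (P.links p).card_le_univ
        linarith

/-- Only the scalar factor `ρ` has to be found: either the load at `ρ = 0` fits, or the intermediate
value theorem yields a `ρ` that saturates the link. -/
theorem Regular.exists_isLinkSolution (H : P.Regular) {μ : L → ℝ} (hμ : 0 ≤ μ) {l : L}
    (hl : 0 < μ l) : ∃ r m φ, P.IsLinkSolution l (fun p => P.share μ p l) r m φ := by
  set T : ℝ → ℝ := fun ρ => P.load (fun p => P.response p (ρ * P.price μ p)) l with hT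
  have hcont : Continuous T := continuous_finsetSum _ fun p _ =>
    (H.continuous_response p).comp (continuous_id.mul continuous_const)
  obtain ⟨ρ, hρ, hle, hslack⟩ : ∃ ρ, 0 ≤ ρ ∧ T ρ ≤ P.cap l ∧ ρ * (T ρ - P.cap l) = 0 := by
    rcases le_or_gt (T 0) (P.cap l) with h0 | h0
    · exact ⟨0, le_rfl, h0, zero_mul _⟩
    · set K := ∑ p, |derivWithin (P.cost p) P.dom 0| with hK
      have hK0 : 0 ≤ K := Finset.sum_nonneg fun _ _ => abs_nonneg _
      -- Path prices are at least `μ l`, so this factor posts at least `K` to every flow, enough to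
      -- drive all rates to zero.
      have hR : T (K / μ l) = 0 := by
        refine Finset.sum_eq_zero fun p hp => H.response_eq_zero ?_
        have h1 : |derivWithin (P.cost p) P.dom 0| ≤ K :=
          Finset.single_le_sum (f := fun p => |derivWithin (P.cost p) P.dom 0|)
            (fun _ _ => abs_nonneg _) (Finset.mem_univ p)
        have h2 : K ≤ K / μ l * P.price μ p := by
          calc K = K / μ l * μ l := (div_mul_cancel₀ _ hl.ne').symm
            _ ≤ _ := mul_le_mul_of_nonneg_left (le_price hμ (mem_flows.1 hp))
              (div_nonneg hK0 hl.le)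
        exact (neg_le_abs _).trans (h1.trans h2)
      obtain ⟨ρ, hρ, hρT⟩ := intermediate_value_Icc' (div_nonneg hK0 hl.le) hcont.continuousOn
        (show P.cap l ∈ Set.Icc (T (K / μ l)) (T 0) from ⟨hR ▸ (H.cap_pos l).le, h0.le⟩)
      exact ⟨ρ, hρ.1, hρT.le, by rw [hρT, sub_self, mul_zero]⟩
  have hlt : ∀ p ∈ P.flows l, P.response p (ρ * P.price μ p) < P.rateBound := fun p hp =>
    ((Finset.single_le_sum (f := fun p => P.response p (ρ * P.price μ p))
      (fun q _ => H.response_nonneg q _) hp).trans hle).trans_lt (P.cap_lt_rateBound l)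
  have hst := fun p hp => H.isStationary_response (hlt p hp)
  refine ⟨fun p => P.response p (ρ * P.price μ p), ρ * μ l,
    fun p => derivWithin (P.cost p) P.dom (P.response p (ρ * P.price μ p)) + ρ * P.price μ p,
    fun p hp => ?_, hle, mul_nonneg hρ hl.le, ?_, fun p hp => (hst p hp).rate_nonneg,
    fun p hp => (hst p hp).sign_nonneg, fun p hp => ?_⟩
  · have hS : 0 < P.price μ p := hl.trans_le (le_price hμ (mem_flows.1 hp))
    have hα : P.share μ p l * P.price μ p = μ l := div_mul_cancel₀ _ hS.ne'
    linear_combination (-ρ) * hα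
  · rw [mul_right_comm, hslack, zero_mul]
  · rw [mul_assoc, (hst p hp).slackness, mul_zero]

theorem Regular.exists_isRun (H : P.Regular) (μ₀ : L → ℝ) (h₀ : ∀ l, 0 < μ₀ l) :
    ∃ μ r φ, P.IsRun μ r φ ∧ μ 0 = μ₀ := by
  have hnext : ∀ x : {x : (L → ℝ) × (L → ι → ℝ) × (L → ι → ℝ) // 0 ≤ x.1},
      ∃ x' : {x : (L → ℝ) × (L → ι → ℝ) × (L → ι → ℝ) // 0 ≤ x.1},
        (∀ l, 0 < x.1.1 l → P.IsLinkSolution l (fun p => P.share x.1.1 p l) (x'.1.2.1 l)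
          (x'.1.1 l) (x'.1.2.2 l)) ∧
        (∀ l, ¬ 0 < x.1.1 l → x'.1.1 l = x.1.1 l ∧ x'.1.2.1 l = x.1.2.1 l ∧
          x'.1.2.2 l = x.1.2.2 l) := by
    rintro ⟨⟨μ, r, φ⟩, hμ⟩
    have : ∀ l, ∃ (r' : ι → ℝ) (m : ℝ) (φ' : ι → ℝ), 0 ≤ m ∧
        (0 < μ l → P.IsLinkSolution l (fun p => P.share μ p l) r' m φ') ∧
        (¬ 0 < μ l → m = μ l ∧ r' = r l ∧ φ' = φ l) := by
      intro l
      by_cases hl : 0 < μ l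
      · obtain ⟨r', m, φ', h⟩ := H.exists_isLinkSolution hμ hl
        exact ⟨r', m, φ', h.multiplier_nonneg, fun _ => h, fun h => absurd hl h⟩
      · exact ⟨r l, μ l, φ l, hμ l, fun h => absurd h hl, fun _ => ⟨rfl, rfl, rfl⟩⟩
    choose r' m φ' h1 h2 h3 using this
    exact ⟨⟨(m, r', φ'), h1⟩, h2, h3⟩
  choose next hactive hidle using hnext
  let x : ℕ → {x : (L → ℝ) × (L → ι → ℝ) × (L → ι → ℝ) // 0 ≤ x.1} := fun j =>
    Nat.rec ⟨(μ₀, 0, 0), fun l => (h₀ l).le⟩ (fun _ => next) j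
  exact ⟨fun j => (x j).1.1, fun j => (x j).1.2.1, fun j => (x j).1.2.2,
    ⟨h₀, fun j => hactive (x j), fun j => hidle (x j)⟩, rfl⟩

/-- Any limit of the algorithm itself serves; no separate existence argument for dual solutions is
needed. -/
theorem Regular.exists_equilibrium (H : P.Regular) : ∃ m, P.IsEquilibrium m := by
  obtain ⟨μ, r, φ, hrun, -⟩ := H.exists_isRun (fun _ => 1) fun _ => one_pos
  have h : P.IsTrajectory μ r φ := hrun.isStep
  obtain ⟨m, hm, -⟩ := h.exists_isEquilibrium H Nat.hyperfilter_le_atTop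
  exact ⟨m, hm⟩

end

end RoutingProblem

theorem theorem1 {ι L : Type*} [Fintype ι] [Fintype L] [DecidableEq L]
    (P : RoutingProblem ι L)
    (hlinks : ∀ p, (P.links p).Nonempty)
    (hcap : ∀ l, 0 < P.cap l)
    (hdom : Convex ℝ P.dom) (hdom0 : Set.Ici 0 ⊆ P.dom)
    (hconv : ∀ p, StrictConvexOn ℝ P.dom (P.cost p))
    (hdiff : ∀ p, DifferentiableOn ℝ (P.cost p) P.dom) :
    (∀ μ₀ : L → ℝ, (∀ l, 0 < μ₀ l) → ∃ μ r φ, P.IsRun μ r φ ∧ μ 0 = μ₀) ∧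
    P.dualSolutions.Nonempty ∧
    ∃ ropt : ι → ℝ, P.IsPrimalOptimal ropt ∧
      ∀ (μ : ℕ → L → ℝ) (r φ : ℕ → L → ι → ℝ), P.IsRun μ r φ →
        Tendsto (fun j => μ (j + 1) - μ j) atTop (𝓝 0) ∧
        (∃ s, P.IsReadout μ s) ∧
        ∀ s : ℕ → ι → L, P.IsReadout μ s →
          Tendsto (fun j p => r j (s j p) p) atTop (𝓝 ropt) ∧
          Tendsto (fun j => Metric.infDist (μ j, fun p => φ j (s j p) p) P.dualSolutions)
            atTop (𝓝 0) := by
  have H : P.Regular := ⟨hlinks, hcap, hdom, hdom0, hconv, hdiff⟩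
  obtain ⟨m₀, hm₀⟩ := H.exists_equilibrium
  obtain ⟨φ₀, hφ₀⟩ := hm₀.exists_isSaddle H
  refine ⟨H.exists_isRun, ⟨_, hφ₀.mem_dualSolutions H⟩, P.responses m₀, hφ₀.isPrimalOptimal H,
    fun μ r φ hrun => ?_⟩
  have h : P.IsTrajectory μ r φ := hrun.isStep
  refine ⟨h.tendsto_diff H, H.exists_isReadout fun j => (h j).nonneg, fun s hs => ⟨?_, ?_⟩⟩
  -- The shift discards iterate `0`, whose rates and sign multipliers are arbitrary.
  · refine (tendsto_add_atTop_iff_nat 1).1 ((tendsto_iff_ultrafilter _ _ _).2 fun U hU => ?_)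
    obtain ⟨m, f, hm, -, -, hr, -⟩ := h.exists_readout_limit H hs hU
    rwa [hm₀.responses_eq hm H]
  · refine (tendsto_add_atTop_iff_nat 1).1 ((tendsto_iff_ultrafilter _ _ _).2 fun U hU => ?_)
    obtain ⟨m, f, -, hf, hμ, -, hφ⟩ := h.exists_readout_limit H hs hU
    have hlim := ((Metric.continuous_infDist_pt P.dualSolutions).tendsto (m, f)).comp
      (hμ.prodMk_nhds hφ)
    rwa [Metric.infDist_zero_of_mem (hf.mem_dualSolutions H)] at hlim
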